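/- Let $\mathbb F_q$ be a finite field and let $\mathcal C\subseteq\mathbb F_q[x]^n$ be a convolutional code, i.e. an $\mathbb F_q[x]$-submodule, of rank $k$ with $1\le k\le n$. A generator matrix of $\mathcal C$ is a matrix $G=\sum_i G_ix^i\in\mathbb F_q[x]^{k\times n}$ whose rows form a basis of $\mathcal C$; the internal degree $\delta$ of $\mathcal C$ is the maximal degree of the $k\times k$ minors of $G$; $\mathcal C$ is noncatastrophic if $G$ has a right inverse over $\mathbb F_q[x]$ (neither notion depends on the choice of $G$). The support of a family of vectors in $\mathbb F_q[x]^n$ is the set of pairs $(\ell,i)$ such that $x^i$ has nonzero coefficient in the $\ell$-th entry of some member of the family, and the weight of a vector is the size of its support. $\mathcal C$ is MDS if the minimal weight of its nonzero elements equals $(n-k)\left(\left\lfloor\frac{\delta}{k}\right\rfloor+1\right)+\delta+1$. For $j\ge 0$ let $G_j^c\in\mathbb F_q^{k(j+1)\times n(j+1)}$ be the block matrix whose $(s,t)$ block, $0\le s,t\le j$, is $G_{t-s}$ if $s\le t$ and $0$ otherwise. For $1\le r\le k$ put $$\mathrm d_j^r(\mathcal C)=\min\left\{\left|\mathrm{supp}\{v_1G_j^c,\dots,v_rG_j^c\}\right|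 : v_i=(v_i^0,\dots,v_i^j)\in(\mathbb F_q^{k})^{j+1},\ \dim\langle v_1^0,\dots,v_r^0\rangle_{\mathbb F_q}=r\right\},$$ where the support of a family of vectors over $\mathbb F_q$ is the set of positions in which some member is nonzero (this does not depend on $G$), and $$\mathrm d^r(\mathcal C)=\lim_{j\to\infty}\mathrm d_j^r(\mathcal C),\qquad \mathrm d_r(\mathcal C)=\min\left\{\left|\mathrm{supp}\{d_1,\dots,d_r\}\right| : d_i\in\mathcal C,\ \mathrm{rk}\langle d_1,\dots,d_r\rangle_{\mathbb F_q[x]}\ge r\right\}.$$ Let $\mathcal C[0]=\{c(0):c\in\mathcal C\}\subseteq\mathbb F_q^n$, and for a linear code $\mathcal L\subseteq\mathbb F_q^n$ let $\mathrm d_r^H(\mathcal L)$ be its $r$-th generalized Hamming weight, the minimal support size of an $r$-dimensional subspace of $\mathcal L$. Let $\mathcal C$ be a noncatastrophic MDS code of rank $k$ and internal degree $\delta$ as above. - If $k\mid\delta$, then for all $1\le r\le k$ $$\mathrm d^r(\mathcal C)=\mathrm d_r(\mathcal C)=(n-k)\left(\frac{\delta}{k}+1\right)+\delta+r.$$ -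 If $k\nmid\delta$, let $0<a<k$ be such that $\delta=k\left\lceil\frac{\delta}{k}\right\rceil-a$. Then for $1\le r\le a$ $$\mathrm d^r(\mathcal C)=\mathrm d_r(\mathcal C)=(n-k)\left(\left\lfloor\frac{\delta}{k}\right\rfloor+1\right)+\delta+r,$$ and for $a<r\le k$ (the limit $\mathrm d^r(\mathcal C)$ exists and) $$\mathrm d^r(\mathcal C)\le\mathrm d_r^H(\mathcal C[0])+(n-k)\left(\left\lfloor\frac{\delta}{k}\right\rfloor+1\right)+\delta.$$ -/

import Mathlib

open Polynomial Filter Topology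

namespace ConvCode

noncomputable section

/-- The support of a finite family of polynomial vectors: the set of all pairs (position `l`,
degree `i`) such that `x ^ i` occurs with nonzero coefficient in the `l`-th entry of some member
of the family. -/
def polySupp {F : Type*} [Field F] {n : ℕ} {ι : Type*} (d : ι → (Fin n → F[X])) :
    Set (Fin n × ℕ) :=
  {p | ∃ s, (d s p.1).coeff p.2 ≠ 0}

/-- The (Hamming) weight of a polynomial vector: its number of nonzero coefficients. -/
def wt {F : Type*} [Field F] {n : ℕ} (c : Fin n → F[X]) : ℕ :=
  ∑ l, (c l).support.card

/-- `G` is a generator matrix of the convolutional code `C`: its rows form a basis of `C`. -/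
def IsGeneratorMatrix {F : Type*} [Field F] {n k : ℕ} (G : Matrix (Fin k) (Fin n) F[X])
    (C : Submodule F[X] (Fin n → F[X])) : Prop :=
  LinearIndependent F[X] G.row ∧ Submodule.span F[X] (Set.range G.row) = C

/-- The internal degree of a polynomial matrix: the maximal degree of its full-size minors. -/
def internalDegree {F : Type*} [Field F] {n k : ℕ} (G : Matrix (Fin k) (Fin n) F[X]) : ℕ :=
  Finset.univ.sup fun S : Fin k ↪ Fin n => (G.submatrix id S).det.natDegree

/-- `C` is an `(n, k, δ)` convolutional code: a submodule of `F[x]^n` of rank `k` and internal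
degree `δ` (the internal degree is the same for all generator matrices). -/
def IsConvCode {F : Type*} [Field F] {n : ℕ} (k δ : ℕ)
    (C : Submodule F[X] (Fin n → F[X])) : Prop :=
  ∃ G : Matrix (Fin k) (Fin n) F[X], IsGeneratorMatrix G C ∧ internalDegree G = δ

/-- `C` is noncatastrophic: it has a generator matrix with a polynomial right inverse. -/
def IsNoncatastrophic {F : Type*} [Field F] {n : ℕ}
    (C : Submodule F[X] (Fin n → F[X])) : Prop :=
  ∃ (k : ℕ) (G : Matrix (Fin k) (Fin n) F[X]) (H : Matrix (Fin n) (Fin k) F[X]),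
    IsGeneratorMatrix G C ∧ G * H = 1

/-- The free distance of `C`: the minimal weight of a nonzero codeword. -/
def freeDist {F : Type*} [Field F] {n : ℕ} (C : Submodule F[X] (Fin n → F[X])) : ℕ :=
  sInf {w | ∃ c ∈ C, c ≠ 0 ∧ w = wt c}

/-- An `(n, k, δ)` code `C` is MDS if its free distance attains the generalized Singleton bound
`(n - k) (⌊δ / k⌋ + 1) + δ + 1`. -/
def IsMDS {F : Type*} [Field F] {n : ℕ} (k δ : ℕ) (C : Submodule F[X] (Fin n → F[X])) : Prop :=
  freeDist C = (n - k) * (δ / k + 1) + δ + 1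

/-- The `j`-truncated sliding generator matrix: a `(j + 1) × (j + 1)` block matrix whose block in
position `(s, t)` is the coefficient matrix `G_{t - s}` if `s ≤ t`, and `0` otherwise. -/
def slidingMatrix {F : Type*} [Field F] {n k : ℕ} (G : Matrix (Fin k) (Fin n) F[X]) (j : ℕ) :
    Matrix (Fin (j + 1) × Fin k) (Fin (j + 1) × Fin n) F :=
  Matrix.of fun p q =>
    if p.1 ≤ q.1 then (G p.2 q.2).coeff ((q.1 : ℕ) - (p.1 : ℕ)) else 0

/-- The `(r, j)`-generalized column distance, computed with the generator matrix `G`: the minimal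
support size of `v_1 G_j^c, …, v_r G_j^c` with `v_i = (v_i^0, …, v_i^j)` such that
`v_1^0, …, v_r^0` span an `r`-dimensional space. -/
def genColDistTrunc {F : Type*} [Field F] {n k : ℕ} (G : Matrix (Fin k) (Fin n) F[X])
    (r j : ℕ) : ℕ :=
  sInf {w | ∃ v : Fin r → (Fin (j + 1) × Fin k → F),
    Module.finrank F
      (Submodule.span F (Set.range fun i : Fin r => fun a : Fin k => v i (0, a))) = r ∧
    w = Set.ncard {q : Fin (j + 1) × Fin n |
      ∃ i, Matrix.vecMul (v i) (slidingMatrix G j) q ≠ 0}}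

/-- `d` is the `r`-generalized column distance of `C`: for every generator matrix of `C`, the
`(r, j)`-generalized column distances converge to `d` as `j` tends to infinity. -/
def HasGenColDist {F : Type*} [Field F] {n : ℕ} (k : ℕ) (C : Submodule F[X] (Fin n → F[X]))
    (r d : ℕ) : Prop :=
  ∀ G : Matrix (Fin k) (Fin n) F[X], IsGeneratorMatrix G C →
    Tendsto (fun j : ℕ => genColDistTrunc G r j) atTop (𝓝 d)

/-- The `r`-th generalized weight of a convolutional code. -/
def genWeight {F : Type*} [Field F] {n : ℕ} (C : Submodule F[X] (Fin n → F[X])) (r : ℕ) : ℕ :=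
  sInf {w | ∃ d : Fin r → (Fin n → F[X]), (∀ i, d i ∈ C) ∧
    r ≤ Module.finrank F[X] (Submodule.span F[X] (Set.range d)) ∧
    w = (polySupp d).ncard}

/-- The block code `C[0] ⊆ F^n` of the values at `x = 0` of the codewords of `C`. -/
def evalZero {F : Type*} [Field F] {n : ℕ} (C : Submodule F[X] (Fin n → F[X])) :
    Submodule F (Fin n → F) :=
  (C.restrictScalars F).map ((Polynomial.lcoeff F 0).compLeft (Fin n))

/-- The `r`-th generalized Hamming weight of a linear block code. -/
def genHammingWeight {F : Type*} [Field F] {n : ℕ} (L : Submodule F (Fin n → F)) (r : ℕ) : ℕ :=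
  sInf {w | ∃ D : Submodule F (Fin n → F), D ≤ L ∧ Module.finrank F D = r ∧
    w = Set.ncard {l : Fin n | ∃ v ∈ D, v l ≠ 0}}

end

end ConvCode

/-! Put μ = ⌊δ/k⌋ and δ + a = k(μ+1) with 0 < a ≤ k; the case k ∣ δ is a = k. The MDS condition then
says that the free distance is n(μ+1) - a + 1.

Lower bound: if r codewords independent over F have common support of size w, some nonzero
combination vanishes at r - 1 chosen support positions, so w ≥ freeDist + r - 1
(`freeDist_add_card_le`).

Upper bound: a row-reduced generator matrix has row degrees summing to at most δ, and the free
distance then forces exactly a rows of degree μ and all others of degree μ + 1 (`vecDegree_of_mds`).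
The a short rows live on n(μ+1) positions; imposing a - r zeros on their F-span leaves r independent
words that attain the lower bound (`initWeight_add_le`).

The column distances are reduced to polynomial codewords: for a noncatastrophic code their limit is
the least support of r codewords with independent values at 0 (`hasGenColDist_initWeight`). Such
words are independent over F[x], so d_r ≤ d^r and both are squeezed between the two bounds when r ≤
a.

For larger r, an optimal r-dimensional subspace of C[0] is lifted to words of degree at most μ + 1,
and x times the short rows cancels a positions in degree μ + 1 without touching the values at 0
(`initWeight_add_le_genHammingWeight_add`). -/

namespace ConvCode

noncomputable section

/-! ### Linear algebra over F and F[x]. -/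

section LinearAlgebra

variable {F : Type*} [Field F]

/-- A matrix with independent rows has an invertible full-size submatrix. -/
theorem exists_embedding_isUnit_submatrix {m : Type*} [Fintype m] [DecidableEq m] {n : ℕ}
    (M : Matrix m (Fin n) F) (hM : LinearIndependent F M.row) :
    ∃ S : m ↪ Fin n, IsUnit (M.submatrix id S) := by
  have hrank : Module.finrank F (Submodule.span F (Set.range M.col)) = Fintype.card m := by
    rw [← Matrix.rank_eq_finrank_span_cols, hM.rank_matrix]
  obtain ⟨f, hf, -, hli⟩ := Submodule.exists_fun_fin_finrank_span_eq F (Set.range M.col)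
  choose s hs using hf
  let e : m ≃ Fin (Module.finrank F (Submodule.span F (Set.range M.col))) :=
    (Fintype.equivFin m).trans (finCongr hrank.symm)
  have hli' : LinearIndependent F (M.submatrix id (s ∘ e)).col := by
    have hcol : (M.submatrix id (s ∘ e)).col = f ∘ e := funext fun i => hs (e i)
    rw [hcol]
    exact hli.comp e e.injective
  have hinj : Function.Injective (s ∘ e) := by
    intro i j hij
    apply hli'.injective
    funext a
    simp only [Matrix.col_apply, Matrix.submatrix_apply, hij]
  exact ⟨⟨s ∘ e, hinj⟩, Matrix.linearIndependent_cols_iff_isUnit.mp hli'⟩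

/-- A matrix with a right inverse has independent rows. -/
theorem linearIndependent_row_of_mul_eq_one {R m n : Type*} [CommRing R] [Fintype m] [Fintype n]
    [DecidableEq m] {M : Matrix m n R} {N : Matrix n m R} (h : M * N = 1) :
    LinearIndependent R M.row := by
  rw [← Matrix.vecMul_injective_iff]
  intro u v huv
  have := congrArg (fun w => Matrix.vecMul w N) huv
  simpa [Matrix.vecMul_vecMul, h] using this

/-- A matrix over a field with independent rows has a right inverse. -/
theorem exists_mul_eq_one_of_linearIndependent_row {m : Type*} [Fintype m] [DecidableEq m] {n : ℕ}
    {M : Matrix m (Fin n) F} (hM : LinearIndependent F M.row) :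
    ∃ N : Matrix (Fin n) m F, M * N = 1 := by
  have : Function.Surjective M.mulVec := by
    rw [← Matrix.coe_mulVecLin, ← LinearMap.range_eq_top]
    apply Submodule.eq_top_of_finrank_eq
    rw [Module.finrank_fintype_fun_eq_card, ← hM.rank_matrix, Matrix.rank]
  exact Matrix.mulVec_surjective_iff_exists_right_inverse.mp this

theorem coeff_prod_sum_of_natDegree_le {ι : Type*} (s : Finset ι) (p : ι → F[X]) (e : ι → ℕ)
    (h : ∀ i, (p i).natDegree ≤ e i) :
    (∏ i ∈ s, p i).coeff (∑ i ∈ s, e i) = ∏ i ∈ s, (p i).coeff (e i) := by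
  classical
  induction s using Finset.induction_on with
  | empty => simp
  | insert a s ha ih =>
    rw [Finset.prod_insert ha, Finset.sum_insert ha, Finset.prod_insert ha, ← ih]
    refine coeff_mul_add_eq_of_natDegree_le (h a) ?_
    exact (natDegree_prod_le _ _).trans (Finset.sum_le_sum fun i _ => h i)

/-- If the `i`-th row has degree at most `e i`, the coefficient of the determinant at `∑ e i` is
the determinant of the leading coefficients. -/
theorem coeff_det_sum_of_natDegree_le {m : Type*} [Fintype m] [DecidableEq m]
    (M : Matrix m m F[X]) (e : m → ℕ) (h : ∀ i j, (M i j).natDegree ≤ e i) :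
    M.det.coeff (∑ i, e i) = (Matrix.of fun i j => (M i j).coeff (e i)).det := by
  rw [← Matrix.det_transpose, ← Matrix.det_transpose (Matrix.of _), Matrix.det_apply,
    Matrix.det_apply, finsetSum_coeff]
  refine Finset.sum_congr rfl fun σ _ => ?_
  rw [coeff_smul]
  congr 1
  exact coeff_prod_sum_of_natDegree_le _ _ _ fun i => h i _

/-- Polynomial vectors with independent values at `0` are independent. -/
theorem linearIndependent_of_coeff_zero {m : Type*} [Fintype m] {n : ℕ} {d : m → Fin n → F[X]}
    (h : LinearIndependent F fun i l => (d i l).coeff 0) : LinearIndependent F[X] d := by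
  classical
  obtain ⟨N, hN⟩ := exists_mul_eq_one_of_linearIndependent_row
    (M := Matrix.of fun i l => (d i l).coeff 0) h
  -- `N` is a right inverse of d(0), so this determinant takes the value 1 at x = 0.
  have hdet : (Matrix.of d * N.map C).det ≠ 0 := by
    intro h0
    have h1 := congrArg constantCoeff h0
    rw [RingHom.map_det, RingHom.mapMatrix_apply, Matrix.map_mul] at h1
    have h2 : (N.map C).map (constantCoeff (R := F)) = N := by ext; simp
    have h3 : (Matrix.of d).map (constantCoeff (R := F)) =
      Matrix.of fun i l => (d i l).coeff 0 := by ext; simp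
    rw [h2, h3, hN] at h1
    simp at h1
  have := Matrix.linearIndependent_rows_of_det_ne_zero hdet
  exact LinearIndependent.of_comp (Matrix.vecMulLinear (N.map C)) this

/-- In the `F`-span of `m` independent vectors, prescribing `p` linear conditions leaves `r`
independent vectors if `r + p ≤ m`. -/
theorem exists_linearIndependent_mulVec_eq_zero {m : Type*} [Fintype m] {p : Type*} [Fintype p]
    (M : Matrix m p F) {r : ℕ} (h : r + Fintype.card p ≤ Fintype.card m) :
    ∃ c : Fin r → m → F, LinearIndependent F c ∧ ∀ i, Matrix.vecMul (c i) M = 0 := by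
  have h1 := LinearMap.finrank_range_add_finrank_ker M.vecMulLinear
  have h2 : Module.finrank F (LinearMap.range M.vecMulLinear) ≤ Fintype.card p := by
    simpa using Submodule.finrank_le (LinearMap.range M.vecMulLinear)
  rw [Module.finrank_fintype_fun_eq_card] at h1
  obtain ⟨c, hc⟩ := exists_linearIndependent_of_le_finrank
    (R := F) (M := LinearMap.ker M.vecMulLinear) (n := r) (by omega)
  refine ⟨fun i => c i, hc.map' (Submodule.subtype _) (Submodule.ker_subtype _), fun i => ?_⟩
  exact (c i).2

end LinearAlgebra

/-! ### Supports, weights and the free distance. -/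

section Support

variable {F : Type*} [Field F] {n : ℕ}

/-- The degree of a polynomial vector. -/
def vecDegree (c : Fin n → F[X]) : ℕ :=
  Finset.univ.sup fun l => (c l).natDegree

theorem natDegree_le_vecDegree (c : Fin n → F[X]) (l : Fin n) :
    (c l).natDegree ≤ vecDegree c :=
  Finset.le_sup (f := fun l => (c l).natDegree) (Finset.mem_univ l)

theorem polySupp_finite {ι : Type*} [Finite ι] (d : ι → Fin n → F[X]) : (polySupp d).Finite := by
  have : polySupp d = ⋃ s, ⋃ l, Prod.mk l '' ((d s l).support : Set ℕ) := by
    ext ⟨l, i⟩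
    simp [polySupp]
  rw [this]
  exact Set.finite_iUnion fun s => Set.finite_iUnion fun l => (Finset.finite_toSet _).image _

theorem wt_le_card {c : Fin n → F[X]} {T : Finset (Fin n × ℕ)}
    (h : ∀ l i, (c l).coeff i ≠ 0 → (l, i) ∈ T) : wt c ≤ T.card := by
  rw [wt, ← Finset.card_sigma]
  refine Finset.card_le_card_of_injOn (fun p => (p.1, p.2)) ?_ ?_
  · rintro ⟨l, i⟩ hp
    simp only [Finset.coe_sigma, Set.mem_sigma_iff, Finset.mem_coe, mem_support_iff] at hp
    exact h l i hp.2
  · rintro ⟨l, i⟩ - ⟨l', i'⟩ - h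
    simp only [Prod.mk.injEq] at h
    obtain ⟨rfl, rfl⟩ := h
    rfl

theorem freeDist_le_wt {C : Submodule F[X] (Fin n → F[X])} {c : Fin n → F[X]} (hc : c ∈ C)
    (h0 : c ≠ 0) : freeDist C ≤ wt c :=
  Nat.sInf_le ⟨c, hc, h0, rfl⟩

/-- Independent codewords have a common support of size at least `freeDist C + card m - 1`. -/
theorem freeDist_add_card_le {C : Submodule F[X] (Fin n → F[X])} {m : Type*} [Fintype m]
    [Nonempty m] {d : m → Fin n → F[X]} (hd : ∀ i, d i ∈ C) (hli : LinearIndependent F d)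
    {T : Finset (Fin n × ℕ)} (hT : ∀ s l i, (d s l).coeff i ≠ 0 → (l, i) ∈ T) :
    freeDist C + Fintype.card m ≤ T.card + 1 := by
  classical
  have hm : 0 < Fintype.card m := Fintype.card_pos
  -- Zeros at `card m - 1` positions still leave a nonzero combination. The minimum covers the case
  -- of a small `T`, which `hpos` below rules out.
  obtain ⟨P, hPT, hP⟩ := Finset.exists_subset_card_eq
    (s := T) (n := min (Fintype.card m - 1) T.card) (min_le_right _ _)
  obtain ⟨c, hc, hc0⟩ := exists_linearIndependent_mulVec_eq_zero (r := 1)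
    (Matrix.of fun (s : m) (p : P) => (d s p.1.1).coeff p.1.2)
    (by rw [Fintype.card_coe, hP]; omega)
  have he0 : ∑ s, c 0 s • d s ≠ 0 := by
    intro h
    exact hc.ne_zero 0 (funext fun s => Fintype.linearIndependent_iff.mp hli _ h s)
  have heC : ∑ s, c 0 s • d s ∈ C :=
    C.sum_mem fun s _ => by
      rw [← algebraMap_smul F[X] (c 0 s) (d s)]
      exact C.smul_mem _ (hd s)
  have hcoeff : ∀ l i, ((∑ s, c 0 s • d s) l).coeff i = ∑ s, c 0 s * (d s l).coeff i := by
    intro l i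
    simp [finsetSum_coeff]
  have hwt : wt (∑ s, c 0 s • d s) ≤ (T \ P).card := by
    refine wt_le_card fun l i h => Finset.mem_sdiff.mpr ⟨?_, fun hp => h ?_⟩
    · rw [hcoeff] at h
      obtain ⟨s, -, hs⟩ := Finset.exists_ne_zero_of_sum_ne_zero h
      exact hT s l i (right_ne_zero_of_mul hs)
    · rw [hcoeff]
      exact congrFun (hc0 0) ⟨(l, i), hp⟩
  have hpos : wt (∑ s, c 0 s • d s) ≠ 0 := by
    intro h
    apply he0
    funext l
    have := (Finset.sum_eq_zero_iff.mp h) l (Finset.mem_univ l)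
    simpa using this
  have hfd := freeDist_le_wt heC he0
  rw [Finset.card_sdiff_of_subset hPT, hP] at hwt
  omega

end Support

/-! ### Generator matrices and row reduction. -/

section GeneratorMatrix

variable {F : Type*} [Field F] {n k : ℕ} {G : Matrix (Fin k) (Fin n) F[X]}
  {C : Submodule F[X] (Fin n → F[X])}

theorem IsGeneratorMatrix.mem_iff (hG : IsGeneratorMatrix G C) {c : Fin n → F[X]} :
    c ∈ C ↔ ∃ u : Fin k → F[X], Matrix.vecMul u G = c := by
  rw [← hG.2, ← range_vecMulLinear, LinearMap.mem_range]
  rfl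

theorem IsGeneratorMatrix.vecMul_mem (hG : IsGeneratorMatrix G C) (u : Fin k → F[X]) :
    Matrix.vecMul u G ∈ C :=
  hG.mem_iff.mpr ⟨u, rfl⟩

theorem IsGeneratorMatrix.row_mem (hG : IsGeneratorMatrix G C) (i : Fin k) : G i ∈ C := by
  rw [← hG.2]
  exact Submodule.subset_span ⟨i, rfl⟩

theorem IsGeneratorMatrix.exists_mul_eq (hG : IsGeneratorMatrix G C) {m : Type*}
    {M : Matrix m (Fin n) F[X]} (hM : ∀ i, M i ∈ C) : ∃ U : Matrix m (Fin k) F[X], U * G = M := by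
  choose U hU using fun i => hG.mem_iff.mp (hM i)
  exact ⟨Matrix.of U, funext fun i => by rw [Matrix.mul_apply_eq_vecMul]; exact hU i⟩

theorem IsGeneratorMatrix.mul_left_injective (hG : IsGeneratorMatrix G C) {m : Type*}
    {U V : Matrix m (Fin k) F[X]} (h : U * G = V * G) : U = V := by
  funext i
  apply Matrix.vecMul_injective_iff.mpr hG.1
  have := congrFun h i
  rwa [Matrix.mul_apply_eq_vecMul, Matrix.mul_apply_eq_vecMul] at this

/-- Every generator matrix of a noncatastrophic code has a polynomial right inverse. -/
theorem IsNoncatastrophic.exists_mul_eq_one (hnc : IsNoncatastrophic C)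
    (hG : IsGeneratorMatrix G C) : ∃ H : Matrix (Fin n) (Fin k) F[X], G * H = 1 := by
  obtain ⟨k', G', H', hG', hH'⟩ := hnc
  obtain ⟨U, hU⟩ := hG'.exists_mul_eq hG.row_mem
  obtain ⟨V, hV⟩ := hG.exists_mul_eq hG'.row_mem
  refine ⟨H' * V, ?_⟩
  -- This one-sided identity suffices, so k' = k need not be known.
  have h1 : U * V = 1 := hG.mul_left_injective (by rw [Matrix.mul_assoc, hV, hU, Matrix.one_mul])
  rw [← Matrix.mul_assoc, ← hU, Matrix.mul_assoc U, hH', Matrix.mul_one, h1]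

theorem IsGeneratorMatrix.unit_mul (hG : IsGeneratorMatrix G C) {U : Matrix (Fin k) (Fin k) F[X]}
    (hU : IsUnit U.det) : IsGeneratorMatrix (U * G) C := by
  have hmul : ∀ u : Fin k → F[X], Matrix.vecMul u (U * G) = Matrix.vecMul (Matrix.vecMul u U) G :=
    fun u => (Matrix.vecMul_vecMul u U G).symm
  constructor
  · rw [← Matrix.vecMul_injective_iff]
    intro u v huv
    simp only [hmul] at huv
    have h1 := Matrix.vecMul_injective_iff.mpr hG.1 huv
    have h2 := congrArg (fun w => Matrix.vecMul w U⁻¹) h1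
    simpa [Matrix.vecMul_vecMul, Matrix.mul_nonsing_inv U hU] using h2
  · ext c
    rw [hG.mem_iff, ← range_vecMulLinear, LinearMap.mem_range]
    constructor
    · rintro ⟨u, rfl⟩
      exact ⟨Matrix.vecMul u U, (hmul u).symm⟩
    · rintro ⟨u, rfl⟩
      refine ⟨Matrix.vecMul u U⁻¹, ?_⟩
      rw [Matrix.vecMulLinear_apply, Matrix.vecMul_vecMul, ← Matrix.mul_assoc,
        Matrix.nonsing_inv_mul U hU, Matrix.one_mul]

/-- The matrix of leading row coefficients of a polynomial matrix. -/
def leadingMatrix (G : Matrix (Fin k) (Fin n) F[X]) : Matrix (Fin k) (Fin n) F :=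
  Matrix.of fun i l => (G i l).coeff (vecDegree (G i))

/-- Every code has a row-reduced generator matrix. -/
theorem IsGeneratorMatrix.exists_reduced (hG : IsGeneratorMatrix G C) :
    ∃ U : Matrix (Fin k) (Fin k) F[X], IsUnit U.det ∧
      LinearIndependent F (leadingMatrix (U * G)).row := by
  classical
  -- A unimodular `U` minimizing the total row degree works: a relation between leading rows would
  -- lower the degree of some row.
  let f : Matrix (Fin k) (Fin k) F[X] → ℕ := fun U => ∑ i, vecDegree ((U * G) i)
  obtain ⟨U, hU, hmin⟩ := WellFounded.has_min (measure f).wf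
    {U : Matrix (Fin k) (Fin k) F[X] | IsUnit U.det} ⟨1, by simp⟩
  refine ⟨U, hU, ?_⟩
  by_contra hli
  obtain ⟨g, hg0, i₁, hi₁⟩ := Fintype.not_linearIndependent_iff.mp hli
  set e : Fin k → ℕ := fun i => vecDegree ((U * G) i) with he
  obtain ⟨i₀, hi₀, hmax⟩ := Finset.exists_max_image (Finset.univ.filter fun i => g i ≠ 0) e
    ⟨i₁, by simpa using hi₁⟩
  simp only [Finset.mem_filter, Finset.mem_univ, true_and] at hi₀ hmax
  -- `i₀` has maximal degree among the rows in the relation, so the powers of x align all leading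
  -- terms in degree `e i₀`, where they cancel.
  let w : Fin k → F[X] := fun i => Polynomial.C (g i) * X ^ (e i₀ - e i)
  let V := U.updateRow i₀ (∑ i, w i • U i)
  have hV : IsUnit V.det := by
    rw [Matrix.det_updateRow_sum]
    simpa [w, hi₀] using hU
  have hVG : V * G = (U * G).updateRow i₀ (∑ i, w i • (U * G) i) := by
    rw [Matrix.updateRow_mul]
    congr 1
    rw [Matrix.sum_vecMul]
    simp only [Matrix.smul_vecMul, Matrix.mul_apply_eq_vecMul]
  have hrow : (V * G) i₀ = ∑ i, w i • (U * G) i := by rw [hVG, Matrix.updateRow_self]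
  have hdeg : ∀ l, ((V * G) i₀ l).natDegree ≤ e i₀ := by
    intro l
    rw [hrow, Finset.sum_apply]
    refine natDegree_sum_le_of_forall_le _ _ fun i _ => ?_
    by_cases hi : g i = 0
    · simp [w, hi]
    · have h1 := hmax i hi
      have h2 := natDegree_le_vecDegree ((U * G) i) l
      have h3 : (w i).natDegree ≤ e i₀ - e i := natDegree_C_mul_X_pow_le _ _
      have h4 : (w i * (U * G) i l).natDegree ≤ _ := natDegree_mul_le
      simp only [Pi.smul_apply, smul_eq_mul]
      simp only [he] at *
      omega
  have hcoeff : ∀ l, ((V * G) i₀ l).coeff (e i₀) = 0 := by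
    intro l
    have h0 := congrFun hg0 l
    rw [Finset.sum_apply] at h0
    rw [hrow, Finset.sum_apply, finsetSum_coeff]
    rw [← Pi.zero_apply (M := fun _ => F) l, ← h0]
    refine Finset.sum_congr rfl fun i _ => ?_
    by_cases hi : g i = 0
    · simp [w, hi]
    · have h1 := hmax i hi
      simp only [w, Pi.smul_apply, smul_eq_mul, Matrix.row_apply, leadingMatrix, Matrix.of_apply]
      rw [mul_assoc, coeff_C_mul, coeff_X_pow_mul', if_pos (Nat.sub_le _ _),
        Nat.sub_sub_self h1]
  have hlt : ∀ l, ((V * G) i₀ l).natDegree < e i₀ ∨ (V * G) i₀ l = 0 := by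
    intro l
    rcases (hdeg l).lt_or_eq with h | h
    · exact Or.inl h
    · right
      rw [← leadingCoeff_eq_zero, leadingCoeff, h, hcoeff]
  -- If `e i₀ = 0` the cancellation would make the new row zero; as it is nonzero, its degree really
  -- drops.
  have hne : (V * G) i₀ ≠ 0 := (hG.unit_mul hV).1.ne_zero i₀
  obtain ⟨l₀, hl₀⟩ := Function.ne_iff.mp hne
  have hpos : 0 < e i₀ := by
    rcases hlt l₀ with h | h
    · omega
    · exact absurd h hl₀
  have hvd : vecDegree ((V * G) i₀) < e i₀ := by
    rw [vecDegree, Finset.sup_lt_iff hpos]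
    intro l _
    rcases hlt l with h | h
    · exact h
    · rw [h]; simpa using hpos
  have hlt' : f V < f U := by
    refine Finset.sum_lt_sum (fun i _ => ?_) ⟨i₀, Finset.mem_univ _, hvd⟩
    by_cases hi : i = i₀
    · subst hi; exact hvd.le
    · rw [hVG, Matrix.updateRow_ne hi]
  exact hmin V hV hlt'

/-- The sum of the row degrees of a row-reduced matrix is at most its internal degree. -/
theorem sum_vecDegree_le_internalDegree (h : LinearIndependent F (leadingMatrix G).row) :
    ∑ i, vecDegree (G i) ≤ internalDegree G := by
  obtain ⟨S, hS⟩ := exists_embedding_isUnit_submatrix _ h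
  have h1 := coeff_det_sum_of_natDegree_le (G.submatrix id S) (fun i => vecDegree (G i))
    fun i j => natDegree_le_vecDegree (G i) (S j)
  have h2 : (G.submatrix id S).det.coeff (∑ i, vecDegree (G i)) ≠ 0 := by
    rw [h1]
    exact ((Matrix.isUnit_iff_isUnit_det _).mp hS).ne_zero
  exact (le_natDegree_of_ne_zero h2).trans
    (Finset.le_sup (f := fun S : Fin k ↪ Fin n => (G.submatrix id S).det.natDegree)
      (Finset.mem_univ S))

theorem internalDegree_unit_mul {U : Matrix (Fin k) (Fin k) F[X]} (hU : IsUnit U.det) :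
    internalDegree (U * G) = internalDegree G := by
  unfold internalDegree
  congr 1
  funext S
  have : (U * G).submatrix id S = U * G.submatrix id S := by
    ext; simp [Matrix.mul_apply]
  obtain ⟨c, hc, hcU⟩ := Polynomial.isUnit_iff.mp hU
  rw [this, Matrix.det_mul, ← hcU, natDegree_C_mul hc.ne_zero]

end GeneratorMatrix

/-! ### The limit of the generalized column distances. -/

section ColumnDistance

variable {F : Type*} [Field F] {n k : ℕ} {G : Matrix (Fin k) (Fin n) F[X]}
  {C : Submodule F[X] (Fin n → F[X])}

/-- The minimal support size of `r` codewords with independent values at `0`. -/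
def initWeight (C : Submodule F[X] (Fin n → F[X])) (r : ℕ) : ℕ :=
  sInf {w | ∃ d : Fin r → (Fin n → F[X]), (∀ i, d i ∈ C) ∧
    LinearIndependent F (fun i l => (d i l).coeff 0) ∧ w = (polySupp d).ncard}

/-- The polynomial with prescribed coefficients in degrees below `N`. -/
def polyOfCoeffs (N : ℕ) (f : ℕ → F) : F[X] :=
  ∑ i ∈ Finset.range N, monomial i (f i)

theorem coeff_polyOfCoeffs (N : ℕ) (f : ℕ → F) (t : ℕ) :
    (polyOfCoeffs N f).coeff t = if t < N then f t else 0 := by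
  simp [polyOfCoeffs, finsetSum_coeff, coeff_monomial]

theorem coeff_mul_eq_sum_range (p q : F[X]) (t : ℕ) :
    (p * q).coeff t = ∑ s ∈ Finset.range (t + 1), p.coeff s * q.coeff (t - s) := by
  rw [coeff_mul, Finset.Nat.sum_antidiagonal_eq_sum_range_succ_mk]

/-- The blocks G_{t-s} make the product a convolution: the sliding matrix is multiplication by `G`
seen in degrees up to j. -/
theorem vecMul_slidingMatrix (u : Fin k → F[X]) (j : ℕ) (t : Fin (j + 1)) (l : Fin n) :
    Matrix.vecMul (fun p : Fin (j + 1) × Fin k => (u p.2).coeff p.1) (slidingMatrix G j) (t, l) =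
      ((Matrix.vecMul u G) l).coeff t := by
  simp only [Matrix.vecMul, dotProduct, finsetSum_coeff, Fintype.sum_prod_type_right,
    slidingMatrix, Matrix.of_apply, coeff_mul_eq_sum_range]
  refine Finset.sum_congr rfl fun a _ => ?_
  have h := Fin.sum_univ_eq_sum_range (n := j + 1) (fun s : ℕ =>
    (u a).coeff s * if s ≤ t then (G a l).coeff (t - s) else 0)
  simp only [Fin.le_def]
  rw [h]
  symm
  refine Finset.sum_subset_zero_on_sdiff ?_ ?_ ?_
  · intro s hs
    have := t.2
    simp only [Finset.mem_range] at hs ⊢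
    omega
  · intro s hs
    have h1 : ¬ s ≤ (t : ℕ) := by
      simp only [Finset.mem_sdiff, Finset.mem_range] at hs
      omega
    simp [h1]
  · intro s hs
    have h1 : s ≤ (t : ℕ) := by
      simp only [Finset.mem_range] at hs
      omega
    simp [h1]

theorem coeff_vecMul_congr {u u' : Fin k → F[X]} {t : ℕ}
    (h : ∀ a, ∀ s ≤ t, (u a).coeff s = (u' a).coeff s) (l : Fin n) :
    ((Matrix.vecMul u G) l).coeff t = ((Matrix.vecMul u' G) l).coeff t := by
  simp only [Matrix.vecMul, dotProduct, finsetSum_coeff, coeff_mul_eq_sum_range]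
  refine Finset.sum_congr rfl fun a _ => Finset.sum_congr rfl fun s hs => ?_
  rw [h a s (by simp only [Finset.mem_range] at hs; omega)]

/-- If the entries of `H` have degree less than `h`, the coefficient of `c H` at `t` only depends
on the coefficients of `c` in degrees between `t - h` and `t`. -/
theorem coeff_vecMul_eq_zero {m₁ m₂ : Type*} [Fintype m₁] {H : Matrix m₁ m₂ F[X]}
    {h s t : ℕ} (hH : ∀ l a, (H l a).natDegree < h) (hst : s + h ≤ t + 1) {c : m₁ → F[X]}
    (hc : ∀ l i, s ≤ i → i ≤ t → (c l).coeff i = 0) (a : m₂) :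
    ((Matrix.vecMul c H) a).coeff t = 0 := by
  simp only [Matrix.vecMul, dotProduct, finsetSum_coeff, coeff_mul_eq_sum_range]
  refine Finset.sum_eq_zero fun l _ => Finset.sum_eq_zero fun i hi => ?_
  simp only [Finset.mem_range] at hi
  by_cases hsi : s ≤ i
  · rw [hc l i hsi (by omega), zero_mul]
  · rw [coeff_eq_zero_of_natDegree_lt (p := H l a), mul_zero]
    have := hH l a
    omega

/-- Evaluate `G * H = 1` at x = 0. -/
theorem linearIndependent_row_coeff_zero {H : Matrix (Fin n) (Fin k) F[X]} (hH : G * H = 1) :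
    LinearIndependent F (G.map (constantCoeff (R := F))).row := by
  refine linearIndependent_row_of_mul_eq_one (N := H.map (constantCoeff (R := F))) ?_
  rw [← Matrix.map_mul, hH]
  exact Matrix.map_one _ (map_zero _) (map_one _)

theorem coeff_zero_vecMul (u : Fin k → F[X]) :
    (fun l => ((Matrix.vecMul u G) l).coeff 0) =
      Matrix.vecMul (fun a => (u a).coeff 0) (G.map (constantCoeff (R := F))) := by
  funext l
  simp [Matrix.vecMul, dotProduct, finsetSum_coeff]

/-- Since G(0) acts injectively, the condition on the v_i^0 in the column distance matches the
condition on codewords in `initWeight`. -/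
theorem linearIndependent_coeff_zero_vecMul_iff {H : Matrix (Fin n) (Fin k) F[X]}
    (hH : G * H = 1) {ι : Type*} (u : ι → Fin k → F[X]) :
    LinearIndependent F (fun i l => ((Matrix.vecMul (u i) G) l).coeff 0) ↔
      LinearIndependent F (fun i a => (u i a).coeff 0) := by
  have h1 : (fun i l => ((Matrix.vecMul (u i) G) l).coeff 0) =
      (G.map (constantCoeff (R := F))).vecMulLinear ∘ fun i a => (u i a).coeff 0 :=
    funext fun i => coeff_zero_vecMul (u i)
  rw [h1, LinearMap.linearIndependent_iff]
  rw [LinearMap.ker_eq_bot]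
  exact Matrix.vecMul_injective_iff.mpr (linearIndependent_row_coeff_zero hH)

/-- An infimum over the empty set would be 0; nonemptiness guarantees a minimizer. -/
theorem initWeight_set_nonempty (hG : IsGeneratorMatrix G C) {H : Matrix (Fin n) (Fin k) F[X]}
    (hH : G * H = 1) {r : ℕ} (hr : r ≤ k) :
    {w | ∃ d : Fin r → (Fin n → F[X]), (∀ i, d i ∈ C) ∧
      LinearIndependent F (fun i l => (d i l).coeff 0) ∧ w = (polySupp d).ncard}.Nonempty :=
  ⟨_, fun i => G (Fin.castLE hr i), fun _ => hG.row_mem _,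
    (linearIndependent_row_coeff_zero hH).comp (Fin.castLE hr) (Fin.castLE_injective hr), rfl⟩

theorem linearIndependent_iff_finrank_span_eq {r : ℕ} {V : Type*} [AddCommGroup V] [Module F V]
    (b : Fin r → V) :
    Module.finrank F (Submodule.span F (Set.range b)) = r ↔ LinearIndependent F b := by
  rw [linearIndependent_iff_card_eq_finrank_span, Fintype.card_fin, eq_comm]
  rfl

/-- Truncating codewords to degrees up to j can only shrink their support. -/
theorem genColDistTrunc_le_initWeight (hG : IsGeneratorMatrix G C)
    {H : Matrix (Fin n) (Fin k) F[X]} (hH : G * H = 1) {r : ℕ} (hr : r ≤ k) (j : ℕ) :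
    genColDistTrunc G r j ≤ initWeight C r := by
  obtain ⟨d, hdC, hd, hw⟩ := Nat.sInf_mem (initWeight_set_nonempty hG hH hr)
  rw [initWeight, hw]
  choose u hu using fun i => hG.mem_iff.mp (hdC i)
  obtain rfl : (fun i => Matrix.vecMul (u i) G) = d := funext hu
  refine (Nat.sInf_le ⟨fun i p => (u i p.2).coeff p.1, ?_, rfl⟩ :
    genColDistTrunc G r j ≤ _).trans ?_
  · rw [linearIndependent_iff_finrank_span_eq]
    exact (linearIndependent_coeff_zero_vecMul_iff hH u).mp hd
  · refine Set.ncard_le_ncard_of_injOn (fun q => (q.2, (q.1 : ℕ))) ?_ ?_ (polySupp_finite _)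
    · rintro ⟨t, l⟩ ⟨i, hi⟩
      rw [vecMul_slidingMatrix] at hi
      exact ⟨i, hi⟩
    · rintro ⟨t, l⟩ - ⟨t', l'⟩ - h
      simp only [Prod.mk.injEq] at h
      exact Prod.ext (Fin.ext h.2) h.1

/-- A set of size at most `W` in a strip of length at least `(W + 1) * L` misses one of the first
`W + 1` blocks of length `L`. -/
theorem exists_block_disjoint {N W L : ℕ} {α : Type*} [Finite α] (T : Set (Fin N × α))
    (hT : T.ncard ≤ W) :
    ∃ b ≤ W, ∀ q ∈ T, ¬ (b * L ≤ (q.1 : ℕ) ∧ (q.1 : ℕ) < b * L + L) := by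
  by_contra! hcon
  choose q hqT hq1 hq2 using fun b : Fin (W + 1) => hcon b (Nat.lt_succ_iff.mp b.2)
  have hinj : Function.Injective q := by
    have key : ∀ b, ((q b).1 : ℕ) / L = b := fun b =>
      Nat.div_eq_of_lt_le (hq1 b) (by rw [Nat.succ_mul]; exact hq2 b)
    intro b b' h
    apply Fin.ext
    rw [← key b, ← key b', h]
  have h1 : (Set.range q).ncard ≤ T.ncard :=
    Set.ncard_le_ncard (Set.range_subset_iff.mpr hqT) (Set.toFinite _)
  rw [Set.ncard_range_of_injective hinj, Nat.card_eq_fintype_card, Fintype.card_fin] at h1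
  omega

/-- A truncated family of small support has a long gap when j is large. Inside the gap the messages,
recovered as `c * H`, vanish too, so they can be cut there; the resulting polynomial codewords have
no support beyond the gap. -/
theorem initWeight_le_genColDistTrunc (hG : IsGeneratorMatrix G C)
    {H : Matrix (Fin n) (Fin k) F[X]} (hH : G * H = 1) {r : ℕ} (hr : r ≤ k) {h m j : ℕ}
    (hHdeg : ∀ l a, (H l a).natDegree < h) (hh : 0 < h)
    (hGdeg : ∀ a l, (G a l).natDegree < m)
    (hj : (initWeight C r + 1) * (h + m) ≤ j + 1) :
    initWeight C r ≤ genColDistTrunc G r j := by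
  by_contra! hlt
  have hne : {w | ∃ v : Fin r → (Fin (j + 1) × Fin k → F),
      Module.finrank F
        (Submodule.span F (Set.range fun i : Fin r => fun a : Fin k => v i (0, a))) = r ∧
      w = Set.ncard {q : Fin (j + 1) × Fin n |
        ∃ i, Matrix.vecMul (v i) (slidingMatrix G j) q ≠ 0}}.Nonempty := by
    refine ⟨_, fun i p => if p.2 = Fin.castLE hr i then 1 else 0, ?_, rfl⟩
    rw [linearIndependent_iff_finrank_span_eq]
    have := (Pi.basisFun F (Fin k)).linearIndependent.comp _ (Fin.castLE_injective hr)
    convert! this using 1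
    funext i a
    simp [Pi.single_apply]
  obtain ⟨v, hv, hw⟩ := Nat.sInf_mem hne
  change genColDistTrunc G r j = _ at hw
  rw [linearIndependent_iff_finrank_span_eq] at hv
  set T := {q : Fin (j + 1) × Fin n | ∃ i, Matrix.vecMul (v i) (slidingMatrix G j) q ≠ 0} with hTdef
  let u : Fin r → Fin k → F[X] := fun i a =>
    polyOfCoeffs (j + 1) fun s => if hs : s < j + 1 then v i (⟨s, hs⟩, a) else 0
  have huv : ∀ i, (fun p : Fin (j + 1) × Fin k => (u i p.2).coeff p.1) = v i := by
    intro i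
    funext p
    simp only [u, coeff_polyOfCoeffs]
    rw [if_pos p.1.2, dif_pos p.1.2]
  have hT : ∀ (t : Fin (j + 1)) l i, ((Matrix.vecMul (u i) G) l).coeff t ≠ 0 → (t, l) ∈ T := by
    intro t l i ht
    rw [← vecMul_slidingMatrix, huv] at ht
    exact ⟨i, ht⟩
  -- In the gap, the first `h` degrees flush the memory of `H`; the last `m` then contain only zero
  -- message coefficients and flush that of `G`.
  obtain ⟨b, hb, hblock⟩ := exists_block_disjoint (W := initWeight C r) (L := h + m) T (by omega)
  have hbj : b * (h + m) + (h + m) ≤ j + 1 := by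
    refine le_trans ?_ hj
    rw [← Nat.succ_mul]
    exact Nat.mul_le_mul_right _ (by omega)
  set s := b * (h + m)
  have hc0 : ∀ i l t, s ≤ t → t < s + (h + m) → ((Matrix.vecMul (u i) G) l).coeff t = 0 := by
    intro i l t h1 h2
    by_contra hne
    exact hblock _ (hT ⟨t, by omega⟩ l i hne) ⟨h1, h2⟩
  have hu0 : ∀ i a t, s + h ≤ t → t < s + (h + m) → (u i a).coeff t = 0 := by
    intro i a t h1 h2
    have hui : u i = Matrix.vecMul (Matrix.vecMul (u i) G) H := by
      rw [Matrix.vecMul_vecMul, hH, Matrix.vecMul_one]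
    rw [hui]
    exact coeff_vecMul_eq_zero (s := s) hHdeg (by omega)
      (fun l t' h3 h4 => hc0 i l t' h3 (by omega)) a
  let u' : Fin r → Fin k → F[X] := fun i a => polyOfCoeffs (s + h) (u i a).coeff
  have hu' : ∀ i a t, t < s + (h + m) → (u' i a).coeff t = (u i a).coeff t := by
    intro i a t ht
    simp only [u', coeff_polyOfCoeffs]
    split_ifs with h1
    · rfl
    · rw [hu0 i a t (by omega) ht]
  -- Cutting the messages at `s + h > 0` keeps their constant terms, hence the independence at 0.
  have hle : initWeight C r ≤ (polySupp fun i => Matrix.vecMul (u' i) G).ncard := by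
    refine Nat.sInf_le ⟨_, fun i => hG.vecMul_mem _, ?_, rfl⟩
    rw [linearIndependent_coeff_zero_vecMul_iff hH]
    convert! hv using 1
    funext i a
    rw [hu' i a 0 (by omega), ← huv i]
    rfl
  have hle' : (polySupp fun i => Matrix.vecMul (u' i) G).ncard ≤ T.ncard := by
    have hsub : (polySupp fun i => Matrix.vecMul (u' i) G) ⊆
        (fun q : Fin (j + 1) × Fin n => (q.2, (q.1 : ℕ))) '' T := by
      rintro ⟨l, t⟩ ⟨i, hi⟩
      by_cases ht : t < s + (h + m)
      · refine ⟨(⟨t, by omega⟩, l), hT _ l i ?_, rfl⟩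
        rwa [coeff_vecMul_congr (u' := u' i)]
        intro a t' ht'
        exact (hu' i a t' (by simp only at ht'; omega)).symm
      · refine absurd ?_ hi
        refine coeff_vecMul_eq_zero (s := s + h) hGdeg (by simp only; omega) ?_ l
        intro a t' h1 _
        simp only [u', coeff_polyOfCoeffs]
        exact if_neg (by omega)
    exact (Set.ncard_le_ncard hsub (Set.toFinite _)).trans (Set.ncard_image_le (Set.toFinite _))
  omega

/-- The generalized column distance of a noncatastrophic code is the minimal support size of `r`
codewords with independent values at `0`. -/
theorem hasGenColDist_initWeight (hnc : IsNoncatastrophic C) {r : ℕ} (hr : r ≤ k) :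
    HasGenColDist k C r (initWeight C r) := by
  intro G hG
  obtain ⟨H, hH⟩ := hnc.exists_mul_eq_one hG
  let h : ℕ := Finset.univ.sup (fun p : Fin n × Fin k => (H p.1 p.2).natDegree) + 1
  let m : ℕ := Finset.univ.sup (fun p : Fin k × Fin n => (G p.1 p.2).natDegree) + 1
  have hh : ∀ l a, (H l a).natDegree < h := fun l a => Nat.lt_succ_of_le
    (Finset.le_sup (f := fun p : Fin n × Fin k => (H p.1 p.2).natDegree) (Finset.mem_univ (l, a)))
  have hm : ∀ a l, (G a l).natDegree < m := fun a l => Nat.lt_succ_of_le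
    (Finset.le_sup (f := fun p : Fin k × Fin n => (G p.1 p.2).natDegree) (Finset.mem_univ (a, l)))
  refine tendsto_const_nhds.congr' ?_
  filter_upwards [eventually_ge_atTop ((initWeight C r + 1) * (h + m))] with j hj
  exact le_antisymm (initWeight_le_genColDistTrunc hG hH hr hh (Nat.succ_pos _) hm (by omega))
    (genColDistTrunc_le_initWeight hG hH hr j)

end ColumnDistance

/-! ### Row degrees and weights of MDS codes. -/

section MDS

variable {F : Type*} [Field F] {n k : ℕ} {G : Matrix (Fin k) (Fin n) F[X]}
  {C : Submodule F[X] (Fin n → F[X])}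

theorem mem_box_of_coeff_ne_zero {p : F[X]} {m i : ℕ} {l : Fin n} (hp : p.natDegree ≤ m)
    (h : p.coeff i ≠ 0) : (l, i) ∈ (Finset.univ : Finset (Fin n)) ×ˢ Finset.range (m + 1) := by
  have := le_natDegree_of_ne_zero h
  simp only [Finset.mem_product, Finset.mem_univ, true_and, Finset.mem_range]
  omega

theorem card_box (m : ℕ) :
    ((Finset.univ : Finset (Fin n)) ×ˢ Finset.range (m + 1)).card = n * (m + 1) := by
  simp

theorem ncard_polySupp_le {ι : Type*} {d : ι → Fin n → F[X]} {T : Finset (Fin n × ℕ)}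
    (h : ∀ s l i, (d s l).coeff i ≠ 0 → (l, i) ∈ T) : (polySupp d).ncard ≤ T.card := by
  rw [← Set.ncard_coe_finset]
  refine Set.ncard_le_ncard ?_ (Finset.finite_toSet T)
  rintro ⟨l, i⟩ ⟨s, hs⟩
  exact h s l i hs

theorem freeDist_add_card_le_ncard {m : Type*} [Fintype m] [Nonempty m] {d : m → Fin n → F[X]}
    (hd : ∀ i, d i ∈ C) (hli : LinearIndependent F d) :
    freeDist C + Fintype.card m ≤ (polySupp d).ncard + 1 := by
  rw [Set.ncard_eq_toFinset_card _ (polySupp_finite d)]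
  refine freeDist_add_card_le hd hli fun s l i h => ?_
  rw [Set.Finite.mem_toFinset]
  exact ⟨s, h⟩

/-- The generalized weights are bounded above by the generalized column distances. -/
theorem genWeight_le_initWeight (hG : IsGeneratorMatrix G C)
    {H : Matrix (Fin n) (Fin k) F[X]} (hH : G * H = 1) {r : ℕ} (hr : r ≤ k) :
    genWeight C r ≤ initWeight C r := by
  obtain ⟨d, hdC, hd, hw⟩ := Nat.sInf_mem (initWeight_set_nonempty hG hH hr)
  rw [initWeight, hw]
  refine Nat.sInf_le ⟨d, hdC, ?_, rfl⟩
  have := linearIndependent_iff_card_le_finrank_span.mp (linearIndependent_of_coeff_zero hd)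
  rwa [Fintype.card_fin] at this

/-- Independence over F[x] implies independence over F, so the common-support bound applies. -/
theorem freeDist_add_le_genWeight (hG : IsGeneratorMatrix G C) {r : ℕ} (hr1 : 1 ≤ r)
    (hr : r ≤ k) : freeDist C + r ≤ genWeight C r + 1 := by
  have hne : {w | ∃ d : Fin r → (Fin n → F[X]), (∀ i, d i ∈ C) ∧
      r ≤ Module.finrank F[X] (Submodule.span F[X] (Set.range d)) ∧
      w = (polySupp d).ncard}.Nonempty := by
    refine ⟨_, fun i => G (Fin.castLE hr i), fun _ => hG.row_mem _, ?_, rfl⟩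
    have := linearIndependent_iff_card_le_finrank_span.mp
      (hG.1.comp _ (Fin.castLE_injective hr))
    rwa [Fintype.card_fin] at this
  obtain ⟨d, hdC, hd, hw⟩ := Nat.sInf_mem hne
  have hli : LinearIndependent F[X] d := by
    rw [linearIndependent_iff_card_le_finrank_span, Fintype.card_fin]
    exact hd
  have : Nonempty (Fin r) := ⟨⟨0, hr1⟩⟩
  have hliF : LinearIndependent F d :=
    hli.restrict_scalars (R := F) (by
      intro x y hxy
      simpa [Algebra.smul_def] using hxy)
  have := freeDist_add_card_le_ncard hdC hliF
  rw [Fintype.card_fin] at this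
  rw [genWeight, hw]
  exact this

/-- The row degrees of a row-reduced generator matrix of an MDS code take at most two values. -/
theorem vecDegree_of_mds (hG : IsGeneratorMatrix G C) {a μ δ : ℕ} (ha : 0 < a) (hak : a ≤ k)
    (hkn : k ≤ n) (hfd : freeDist C + a = n * (μ + 1) + 1) (hδ : δ + a = k * (μ + 1))
    (hsum : ∑ i, vecDegree (G i) ≤ δ) :
    (Finset.univ.filter fun i => vecDegree (G i) = μ).card = a ∧
      ∀ i, vecDegree (G i) ≤ μ + 1 := by
  classical
  have hliF : LinearIndependent F G.row :=
    hG.1.restrict_scalars (R := F) (by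
      intro x y hxy
      simpa [Algebra.smul_def] using hxy)
  -- A row of degree below μ has weight at most nμ, but the free distance exceeds nμ because a ≤ n.
  have hge : ∀ i, μ ≤ vecDegree (G i) := by
    intro i
    by_contra! hlt
    have h1 := (freeDist_le_wt (hG.row_mem i) (hG.1.ne_zero i)).trans
      (wt_le_card fun l t h => mem_box_of_coeff_ne_zero (natDegree_le_vecDegree (G i) l) h)
    rw [card_box] at h1
    have h2 : n * (vecDegree (G i) + 1) ≤ n * μ := Nat.mul_le_mul_left _ hlt
    have h3 : n * (μ + 1) = n * μ + n := Nat.mul_succ n μ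
    omega
  set A := Finset.univ.filter fun i => vecDegree (G i) = μ with hA
  -- The least degrees compatible with `A`. Their sum k(μ+1) - |A| is at most δ = k(μ+1) - a, whence
  -- |A| ≥ a; once |A| = a, equality of sums forces the degrees to equal `f`.
  let f : Fin k → ℕ := fun i => if vecDegree (G i) = μ then μ else μ + 1
  have hfe : ∀ i, f i ≤ vecDegree (G i) := by
    intro i
    have := hge i
    simp only [f]
    split_ifs <;> omega
  have hfsum : ∑ i, f i + A.card = k * (μ + 1) := by
    rw [hA, Finset.card_filter, ← Finset.sum_add_distrib]
    have : ∀ i, (f i + if vecDegree (G i) = μ then 1 else 0) = μ + 1 := by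
      intro i
      simp only [f]
      split_ifs <;> rfl
    simp [this]
  have hle : ∑ i, f i ≤ ∑ i, vecDegree (G i) := Finset.sum_le_sum fun i _ => hfe i
  have hcard : A.card = a := by
    refine le_antisymm ?_ (by omega)
    have hApos : 0 < A.card := by omega
    obtain ⟨i₀, hi₀⟩ := Finset.card_pos.mp hApos
    have : Nonempty A := ⟨⟨i₀, hi₀⟩⟩
    -- The rows in `A` share a support of size at most n(μ+1), which gives |A| ≤ a.
    have h1 := freeDist_add_card_le (C := C) (d := fun i : A => G i)
      (T := Finset.univ ×ˢ Finset.range (μ + 1)) (fun i => hG.row_mem i)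
      (hliF.comp _ Subtype.val_injective) (fun s l i h => mem_box_of_coeff_ne_zero
        ((natDegree_le_vecDegree (G s) l).trans (Finset.mem_filter.mp s.2).2.le) h)
    rw [card_box, Fintype.card_coe] at h1
    omega
  refine ⟨hcard, fun i => ?_⟩
  have heq := (Finset.sum_eq_sum_iff_of_le fun i _ => hfe i).mp
    (le_antisymm hle (by omega)) i (Finset.mem_univ i)
  rw [← heq]
  simp only [f]
  split_ifs <;> omega

theorem linearIndependent_coeff_zero_sum {H : Matrix (Fin n) (Fin k) F[X]} (hH : G * H = 1)
    {r : ℕ} {m : Type*} [Fintype m] {g : m → Fin k} (hg : Function.Injective g)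
    {c : Fin r → m → F} (hc : LinearIndependent F c) :
    LinearIndependent F fun i l => ((∑ s, c i s • G (g s)) l).coeff 0 := by
  have h1 : LinearIndependent F ((G.map (constantCoeff (R := F))).submatrix g id).row :=
    (linearIndependent_row_coeff_zero hH).comp g hg
  have h2 := hc.map' (Matrix.vecMulLinear ((G.map (constantCoeff (R := F))).submatrix g id))
    (LinearMap.ker_eq_bot.mpr (Matrix.vecMul_injective_iff.mpr h1))
  convert! h2 using 1
  funext i l
  simp [Matrix.vecMul, dotProduct, finsetSum_coeff]

/-- A code with `a` codewords of degree at most `μ` in a generator matrix has small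
`r`-generalized column distance for `r ≤ a`. -/
theorem initWeight_add_le (hG : IsGeneratorMatrix G C) {H : Matrix (Fin n) (Fin k) F[X]}
    (hH : G * H = 1) {A : Finset (Fin k)} {μ r : ℕ} (hA : ∀ i ∈ A, vecDegree (G i) ≤ μ)
    (hkn : k ≤ n) (hr : r ≤ A.card) :
    initWeight C r + A.card ≤ n * (μ + 1) + r := by
  classical
  have hAk : A.card ≤ k := by simpa using A.card_le_univ
  have hn : n ≤ n * (μ + 1) := Nat.le_mul_of_pos_right _ (Nat.succ_pos _)
  -- Requiring zeros at |A| - r positions leaves at least r dimensions of the span of the rows in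
  -- `A`.
  obtain ⟨P, hP, hPcard⟩ := Finset.exists_subset_card_eq
    (s := (Finset.univ : Finset (Fin n)) ×ˢ Finset.range (μ + 1)) (n := A.card - r)
    (by rw [card_box]; omega)
  obtain ⟨c, hc, hc0⟩ := exists_linearIndependent_mulVec_eq_zero (r := r)
    (Matrix.of fun (s : A) (p : P) => (G s p.1.1).coeff p.1.2)
    (by rw [Fintype.card_coe, Fintype.card_coe, hPcard]; omega)
  have hle : initWeight C r ≤ (polySupp fun i => ∑ s : A, c i s • G s).ncard := by
    refine Nat.sInf_le ⟨_, fun i => C.sum_mem fun s _ => ?_,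
      linearIndependent_coeff_zero_sum hH Subtype.val_injective hc, rfl⟩
    rw [← algebraMap_smul F[X] (c i s) (G s)]
    exact C.smul_mem _ (hG.row_mem s)
  have hcard : (polySupp fun i => ∑ s : A, c i s • G s).ncard ≤
      ((Finset.univ ×ˢ Finset.range (μ + 1)) \ P).card := by
    refine ncard_polySupp_le fun s l i h => ?_
    have hcoeff : ((∑ s' : A, c s s' • G s') l).coeff i =
        ∑ s' : A, c s s' * (G s' l).coeff i := by
      simp [finsetSum_coeff]
    rw [hcoeff] at h
    refine Finset.mem_sdiff.mpr ⟨?_, fun hp => h (congrFun (hc0 s) ⟨(l, i), hp⟩)⟩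
    obtain ⟨s', -, hs'⟩ := Finset.exists_ne_zero_of_sum_ne_zero h
    exact mem_box_of_coeff_ne_zero ((natDegree_le_vecDegree (G s') l).trans (hA s' s'.2))
      (right_ne_zero_of_mul hs')
  rw [Finset.card_sdiff_of_subset hP, card_box, hPcard] at hcard
  omega

theorem mem_evalZero_iff {v : Fin n → F} :
    v ∈ evalZero C ↔ ∃ c ∈ C, (fun l => (c l).coeff 0) = v := by
  simp only [evalZero, Submodule.mem_map, Submodule.restrictScalars_mem]
  rfl

theorem genHammingWeight_set_nonempty (hG : IsGeneratorMatrix G C)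
    {H : Matrix (Fin n) (Fin k) F[X]} (hH : G * H = 1) {r : ℕ} (hr : r ≤ k) :
    {w | ∃ D : Submodule F (Fin n → F), D ≤ evalZero C ∧ Module.finrank F D = r ∧
      w = Set.ncard {l : Fin n | ∃ v ∈ D, v l ≠ 0}}.Nonempty := by
  refine ⟨_, Submodule.span F (Set.range fun i : Fin r =>
    (G.map (constantCoeff (R := F))) (Fin.castLE hr i)), ?_, ?_, rfl⟩
  · rw [Submodule.span_le]
    rintro _ ⟨i, rfl⟩
    exact mem_evalZero_iff.mpr ⟨_, hG.row_mem (Fin.castLE hr i), rfl⟩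
  · rw [linearIndependent_iff_finrank_span_eq]
    exact (linearIndependent_row_coeff_zero hH).comp _ (Fin.castLE_injective hr)

/-- Bound for the `r`-generalized column distance of a code with a row-reduced generator matrix
whose rows have degree `μ` (for the rows in `A`) or at most `μ + 1`. -/
theorem initWeight_add_le_genHammingWeight_add (hG : IsGeneratorMatrix G C)
    {H : Matrix (Fin n) (Fin k) F[X]} (hH : G * H = 1)
    (hred : LinearIndependent F (leadingMatrix G).row) {A : Finset (Fin k)} {μ r : ℕ}
    (hA : ∀ i ∈ A, vecDegree (G i) = μ) (hdeg : ∀ i, vecDegree (G i) ≤ μ + 1)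
    (hr : r ≤ k) :
    initWeight C r + A.card ≤ genHammingWeight (evalZero C) r + n * (μ + 1) := by
  classical
  obtain ⟨D, hDC, hDr, hw⟩ := Nat.sInf_mem (genHammingWeight_set_nonempty hG hH hr)
  change genHammingWeight _ _ = _ at hw
  let b := Module.finBasisOfFinrankEq F D hDr
  have hb : LinearIndependent F fun i => (b i : Fin n → F) :=
    b.linearIndependent.map' D.subtype (Submodule.ker_subtype D)
  choose e heC heb using fun i => mem_evalZero_iff.mp (hDC (b i).2)
  choose u hu using fun i => hG.mem_iff.mp (heC i)
  -- Keeping only the constant part of the message preserves the value at 0 and bounds the degree by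
  -- μ + 1.
  let c : Fin r → Fin n → F[X] := fun i => ∑ s, (u i s).coeff 0 • G s
  have hcC : ∀ i, c i ∈ C := fun i => C.sum_mem fun s _ => by
    rw [← algebraMap_smul F[X] ((u i s).coeff 0) (G s)]
    exact C.smul_mem _ (hG.row_mem s)
  have hccoeff : ∀ i l t, (c i l).coeff t = ∑ s, (u i s).coeff 0 * (G s l).coeff t := by
    intro i l t
    simp [c, finsetSum_coeff]
  have hc0 : ∀ i l, (c i l).coeff 0 = (b i : Fin n → F) l := by
    intro i l
    rw [hccoeff, ← congrFun (heb i) l]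
    simp [← hu i, Matrix.vecMul, dotProduct, finsetSum_coeff]
  obtain ⟨S, hS⟩ := exists_embedding_isUnit_submatrix
    ((leadingMatrix G).submatrix (Subtype.val : A → Fin k) id) (hred.comp _ Subtype.val_injective)
  choose z hz using fun i => (Matrix.vecMul_surjective_iff_isUnit.mpr hS)
    fun p => (c i (S p)).coeff (μ + 1)
  let g : Fin r → Fin n → F[X] := fun i => ∑ s : A, z i s • G s
  have hgC : ∀ i, g i ∈ C := fun i => C.sum_mem fun s _ => by
    rw [← algebraMap_smul F[X] (z i s) (G s)]
    exact C.smul_mem _ (hG.row_mem s)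
  have hgcoeff : ∀ i l t, (g i l).coeff t = ∑ s : A, z i s * (G s l).coeff t := by
    intro i l t
    simp [g, finsetSum_coeff]
  have hgS : ∀ i p, (g i (S p)).coeff μ = (c i (S p)).coeff (μ + 1) := by
    intro i p
    rw [hgcoeff, ← congrFun (hz i) p]
    refine Finset.sum_congr rfl fun s _ => ?_
    simp [leadingMatrix, hA s s.2]
  -- The factor x leaves the value at 0 alone and moves the top degree μ of `g i` to μ + 1, where
  -- the coefficients at the columns in `S` cancel.
  let d : Fin r → Fin n → F[X] := fun i => c i - (X : F[X]) • g i
  have hd0 : ∀ i l, (d i l).coeff 0 = (b i : Fin n → F) l := by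
    intro i l
    simp [d, hc0]
  have hd1 : ∀ i l t, (d i l).coeff (t + 1) = (c i l).coeff (t + 1) - (g i l).coeff t := by
    intro i l t
    simp [d]
  have hle : initWeight C r ≤ (polySupp d).ncard := by
    refine Nat.sInf_le ⟨d, fun i => C.sub_mem (hcC i) (C.smul_mem _ (hgC i)), ?_, rfl⟩
    simp only [hd0]
    exact hb
  let Z : Finset (Fin n) := {l : Fin n | ∃ v ∈ D, v l ≠ 0}.toFinset
  have hZ : Z.card = genHammingWeight (evalZero C) r := by
    rw [hw, Set.ncard_eq_toFinset_card']
  -- Degree 0 contributes the support of `D`, degrees 1 to μ at most nμ, and degree μ + 1 at most n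
  -- - |A|.
  have hcard : (polySupp d).ncard ≤ (Z ×ˢ {0} ∪ (Finset.univ ×ˢ Finset.Icc 1 μ ∪
      (Finset.univ.map S)ᶜ ×ˢ {μ + 1})).card := by
    refine ncard_polySupp_le fun i l t h => ?_
    simp only [Finset.mem_union, Finset.mem_product, Finset.mem_singleton, Finset.mem_Icc,
      Finset.mem_univ, true_and, Finset.mem_compl, Finset.mem_map, not_exists]
    rcases t with _ | t
    · left
      rw [hd0] at h
      exact ⟨Set.mem_toFinset.mpr ⟨b i, (b i).2, h⟩, rfl⟩
    · right
      rw [hd1] at h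
      rcases lt_trichotomy t μ with ht | rfl | ht
      · left; omega
      · right
        refine ⟨fun p hp => h ?_, rfl⟩
        rw [← hp, hgS, sub_self]
      · refine absurd ?_ h
        rw [hccoeff, hgcoeff, Finset.sum_eq_zero, Finset.sum_eq_zero, sub_zero]
        · intro s _
          rw [coeff_eq_zero_of_natDegree_lt (p := G s l), mul_zero]
          have h1 := natDegree_le_vecDegree (G s) l
          rw [hA s s.2] at h1
          omega
        · intro s _
          rw [coeff_eq_zero_of_natDegree_lt (p := G s l), mul_zero]
          have h1 := natDegree_le_vecDegree (G s) l
          have h2 := hdeg s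
          omega
  have h1 := Finset.card_union_le (Z ×ˢ {0}) (Finset.univ ×ˢ Finset.Icc 1 μ ∪
    (Finset.univ.map S)ᶜ ×ˢ {μ + 1})
  have h2 := Finset.card_union_le ((Finset.univ : Finset (Fin n)) ×ˢ Finset.Icc 1 μ)
    ((Finset.univ.map S)ᶜ ×ˢ {μ + 1})
  have h3 : Fintype.card A ≤ Fintype.card (Fin n) := Fintype.card_le_of_injective S S.injective
  simp only [Finset.card_product, Finset.card_singleton, mul_one, Finset.card_univ,
    Fintype.card_fin, Nat.card_Icc, Nat.add_sub_cancel, Finset.card_compl, Finset.card_map,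
    Fintype.card_coe] at h1 h2 h3
  have h4 : n * (μ + 1) = n * μ + n := Nat.mul_succ n μ
  omega

/-- Generalized weights and column distances of noncatastrophic MDS codes, where
`δ = k (μ + 1) - a`. -/
theorem weights_of_mds {δ a : ℕ} (ha : 0 < a) (hak : a ≤ k) (hkn : k ≤ n)
    (hδ : δ + a = k * (δ / k + 1)) (hC : IsConvCode k δ C) (hnc : IsNoncatastrophic C)
    (hmds : IsMDS k δ C) :
    (∀ r, 1 ≤ r → r ≤ a → HasGenColDist k C r ((n - k) * (δ / k + 1) + δ + r) ∧
      genWeight C r = (n - k) * (δ / k + 1) + δ + r) ∧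
    ∀ r ≤ k, ∃ d, HasGenColDist k C r d ∧
      d ≤ genHammingWeight (evalZero C) r + (n - k) * (δ / k + 1) + δ := by
  obtain ⟨G₀, hG₀, hdeg₀⟩ := hC
  obtain ⟨U, hU, hred⟩ := hG₀.exists_reduced
  have hG := hG₀.unit_mul hU
  obtain ⟨H, hH⟩ := hnc.exists_mul_eq_one hG
  have hsum := sum_vecDegree_le_internalDegree hred
  rw [internalDegree_unit_mul hU, hdeg₀] at hsum
  rw [IsMDS] at hmds
  -- Together with `hδ`, this rewrites the Singleton bound as n(μ+1) - a + 1.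
  have hn : n * (δ / k + 1) = (n - k) * (δ / k + 1) + k * (δ / k + 1) := by
    rw [← Nat.add_mul, Nat.sub_add_cancel hkn]
  obtain ⟨hcard, hdeg⟩ := vecDegree_of_mds hG ha hak hkn (by omega) hδ hsum
  refine ⟨fun r hr1 hra => ?_, fun r hr => ⟨_, hasGenColDist_initWeight hnc hr, ?_⟩⟩
  · have h1 := freeDist_add_le_genWeight hG hr1 (hra.trans hak)
    have h2 := genWeight_le_initWeight hG hH (hra.trans hak)
    have h3 := initWeight_add_le hG hH (r := r)
      (A := Finset.univ.filter fun i => vecDegree ((U * G₀) i) = δ / k)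
      (fun i hi => le_of_eq (Finset.mem_filter.mp hi).2) hkn (by rw [hcard]; exact hra)
    rw [hcard] at h3
    have h4 : initWeight C r = (n - k) * (δ / k + 1) + δ + r := by omega
    exact ⟨h4 ▸ hasGenColDist_initWeight hnc (hra.trans hak), by omega⟩
  · have h1 := initWeight_add_le_genHammingWeight_add hG hH hred
      (A := Finset.univ.filter fun i => vecDegree ((U * G₀) i) = δ / k)
      (fun i hi => (Finset.mem_filter.mp hi).2) hdeg hr
    rw [hcard] at h1
    omega

end MDS

end

end ConvCode

theorem mainTheorem10 {F : Type*} [Field F] [Finite F] {n k δ : ℕ} (hk : 1 ≤ k) (hkn : k ≤ n)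
    (C : Submodule F[X] (Fin n → F[X])) (hC : ConvCode.IsConvCode k δ C)
    (hnc : ConvCode.IsNoncatastrophic C) (hmds : ConvCode.IsMDS k δ C) :
    (k ∣ δ → ∀ r : ℕ, 1 ≤ r → r ≤ k →
      ConvCode.HasGenColDist k C r ((n - k) * (δ / k + 1) + δ + r) ∧
      ConvCode.genWeight C r = (n - k) * (δ / k + 1) + δ + r) ∧
    (¬ k ∣ δ → ∀ a : ℕ, 0 < a → a < k → (δ : ℤ) = (k : ℤ) * ⌈(δ : ℚ) / (k : ℚ)⌉ - (a : ℤ) →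
      (∀ r : ℕ, 1 ≤ r → r ≤ a →
        ConvCode.HasGenColDist k C r ((n - k) * (δ / k + 1) + δ + r) ∧
        ConvCode.genWeight C r = (n - k) * (δ / k + 1) + δ + r) ∧
      (∀ r : ℕ, a < r → r ≤ k →
        ∃ d : ℕ, ConvCode.HasGenColDist k C r d ∧
          d ≤ ConvCode.genHammingWeight (ConvCode.evalZero C) r +
            (n - k) * (δ / k + 1) + δ)) := by
  refine ⟨fun hdvd => ?_, fun _ a ha hak hδ => ?_⟩
  -- The divisible case is a = k.
  · have hδ : δ + k = k * (δ / k + 1) := by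
      rw [Nat.mul_succ, Nat.mul_div_cancel' hdvd]
    exact (ConvCode.weights_of_mds hk le_rfl hkn hδ hC hnc hmds).1
  -- As 0 < a < k, the ceiling of δ/k is ⌊δ/k⌋ + 1.
  · have hδ' : δ + a = k * (δ / k + 1) := by
      have hdvd : k ∣ δ + a := by
        rw [← Int.natCast_dvd_natCast]
        exact ⟨⌈(δ : ℚ) / (k : ℚ)⌉, by push_cast; linarith⟩
      obtain ⟨m, hm⟩ := hdvd
      have hm1 : m = δ / k + 1 := by
        obtain ⟨m, rfl⟩ : ∃ m', m = m' + 1 :=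
          Nat.exists_eq_succ_of_ne_zero (by rintro rfl; omega)
        rw [Nat.mul_succ] at hm
        congr 1
        symm
        refine Nat.div_eq_of_lt_le ?_ ?_
        · rw [Nat.mul_comm]; omega
        · rw [Nat.succ_mul, Nat.mul_comm]; omega
      rw [hm, hm1]
    obtain ⟨h1, h2⟩ := ConvCode.weights_of_mds ha hak.le hkn hδ' hC hnc hmds
    exact ⟨h1, fun r _ hr => h2 r hr⟩
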